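/- In online square packing, the input is a finite sequence $I$ of squares (items) whose side lengths are rational numbers in $(0,1]$. The items are presented one by one, and each has to be assigned irrevocably to a bin before the next one is known. A set of items may share a bin if they can be placed, axis-parallel and with pairwise disjoint interiors, inside a unit square. The cost $A(I)$ of a deterministic online algorithm $A$ is the number of non-empty bins that it uses for $I$, and $OPT(I)$ is the minimum number of bins in any packing of $I$. The (asymptotic) competitive ratio of $A$ is $$R_A=\limsup_{Q\to\infty}\frac{1}{Q}\,\sup\{A(I) : OPT(I)=Q\}\in[0,\infty].$$ Theorem. The competitive ratio of every deterministic online algorithm for square packing satisfies $R_A\ge 1.7515445$. -/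

import Mathlib

open scoped ENNReal

namespace SquarePacking

/-- An item: a square, given by its side length, a rational number in `(0, 1]`. -/
abbrev Item : Type := {s : ℚ // 0 < s ∧ s ≤ 1}

/-- The closed axis-parallel square with lower left corner `p` and side length `s`. -/
def square (p : ℝ × ℝ) (s : ℝ) : Set (ℝ × ℝ) :=
  Set.Icc p.1 (p.1 + s) ×ˢ Set.Icc p.2 (p.2 + s)

/-- A family of items can be packed into one bin: the items can be placed as axis-parallel
squares inside the closed unit square, with pairwise disjoint interiors (boundaries may touch). -/
def Fits {ι : Type} (item : ι → Item) : Prop :=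
  ∃ pos : ι → ℝ × ℝ,
    (∀ i, square (pos i) ((item i : ℚ) : ℝ) ⊆ square (0, 0) 1) ∧
    Pairwise fun i j => Disjoint (interior (square (pos i) ((item i : ℚ) : ℝ)))
      (interior (square (pos j) ((item j : ℚ) : ℝ)))

/-- `f` assigns a bin (named by a natural number) to every item of the input sequence `I`, and
the items of every bin can be packed into that bin. -/
def IsPacking (I : List Item) (f : Fin I.length → ℕ) : Prop :=
  ∀ b : ℕ, Fits fun i : {i : Fin I.length // f i = b} => I.get i.1

/-- The number of non-empty bins of an assignment. -/
def numBins {n : ℕ} (f : Fin n → ℕ) : ℕ := (Finset.univ.image f).card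

/-- The optimal offline cost of `I`: the least number of bins of a packing of `I`. -/
noncomputable def opt (I : List Item) : ℕ :=
  sInf {k : ℕ | ∃ f : Fin I.length → ℕ, IsPacking I f ∧ numBins f = k}

/-- A deterministic online algorithm: `bin past s` is the bin that receives the item `s` when the
items presented before it are `past`, in this order (the earlier packing decisions are determined
by `past`). On every input the resulting assignment has to be a packing. The algorithm commits
to bins only, not to positions inside a bin; this includes the algorithms that also
commit to positions. -/
structure OnlineAlgorithm where
  bin : List Item → Item → ℕ
  isPacking : ∀ I : List Item, IsPacking I fun i => bin (I.take i) (I.get i)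

namespace OnlineAlgorithm

/-- The number of bins used by the online algorithm `A` for the input `I`. -/
def cost (A : OnlineAlgorithm) (I : List Item) : ℕ :=
  numBins fun i : Fin I.length => A.bin (I.take i) (I.get i)

/-- The supremum (possibly `∞`) of the cost of `A` over all inputs of optimal cost `Q`. -/
noncomputable def worstCost (A : OnlineAlgorithm) (Q : ℕ) : ℝ≥0∞ :=
  ⨆ (I : List Item) (_ : opt I = Q), (A.cost I : ℝ≥0∞)

/-- The asymptotic competitive ratio of `A`, a value in `[0, ∞]`. -/
noncomputable def competitiveRatio (A : OnlineAlgorithm) : ℝ≥0∞ :=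
  Filter.limsup (fun Q : ℕ => A.worstCost Q / (Q : ℝ≥0∞)) Filter.atTop

end OnlineAlgorithm

end SquarePacking

/-! An adversary presents `6K` squares of side 2/25 (above 1/13), then `2K` of side just above 1/4,
then `3K` of side just above 1/3. In the last two phases the sides are chosen by bisection
(`exists_adaptive`): the items that open a new bin are exactly those above a threshold, `τ` for the
quarters and `σ` for the thirds. The adversary may stop after the first phase, after the second
followed by big squares of side `1 - τ`, or after the third followed by big squares of side 33/50 or
of side `1 - σ`. A square of side `1 - τ` cannot enter a bin opened in the second phase, because
that bin holds an item above `τ`; offline it shares a bin with items of side at most `τ`. The same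
holds for `σ` and the third phase.

Explicit layouts bound the offline costs from above (`opt_quarters_le`, `opt_two_thirds_le`,
`opt_thirds_le`). For the online cost, a square longer than `m / k` covers at least `m ^ 2` of the
`(k - 1) ^ 2` interior points of the grid of mesh `1 / k` (`Fits.sum_sq_le`). The meshes 1/13, 1/4
and 1/3 give linear constraints on the contents of a bin, and `bin_weight_le` condenses them into
one weight inequality. Its sum over all bins, together with `exists_receiving`, which expresses the
cost of the big items through the old bins they enter, contradicts a suitable combination of the
four ratio bounds. -/

namespace SquarePacking

/-! ### Necessary conditions for squares to share a bin. -/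

/-- The side length of an item as a real number. -/
noncomputable def side (s : Item) : ℝ := ((s : ℚ) : ℝ)

lemma side_pos (s : Item) : 0 < side s := by
  have := s.2.1
  unfold side
  exact_mod_cast this

lemma interior_square (p : ℝ × ℝ) (s : ℝ) :
    interior (square p s) = Set.Ioo p.1 (p.1 + s) ×ˢ Set.Ioo p.2 (p.2 + s) := by
  rw [square, interior_prod_eq, interior_Icc, interior_Icc]

lemma square_subset_unit_iff {p : ℝ × ℝ} {s : ℝ} (hs : 0 ≤ s) :
    square p s ⊆ square (0, 0) 1 ↔ (0 ≤ p.1 ∧ p.1 + s ≤ 1) ∧ (0 ≤ p.2 ∧ p.2 + s ≤ 1) := by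
  constructor
  · intro h
    have h1 := @h (p.1, p.2) (by
      simp only [square, Set.mem_prod, Set.mem_Icc]
      refine ⟨⟨?_, ?_⟩, ?_, ?_⟩ <;> linarith)
    have h2 := @h (p.1 + s, p.2 + s) (by
      simp only [square, Set.mem_prod, Set.mem_Icc]
      refine ⟨⟨?_, ?_⟩, ?_, ?_⟩ <;> linarith)
    simp only [square, Set.mem_prod, Set.mem_Icc, zero_add] at h1 h2
    exact ⟨⟨h1.1.1, h2.1.2⟩, h1.2.1, h2.2.2⟩
  · rintro ⟨⟨h1, h2⟩, h3, h4⟩ ⟨x, y⟩ hxy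
    simp only [square, Set.mem_prod, Set.mem_Icc, zero_add] at hxy ⊢
    exact ⟨⟨by linarith, by linarith⟩, by linarith, by linarith⟩

/-- Squares with pairwise disjoint interiors in the unit square contain disjoint sets of points
of the grid with mesh `1 / k`. -/
lemma Fits.sum_sq_le {ι : Type} [Fintype ι] {item : ι → Item} (h : Fits item) (k : ℕ)
    (m : ι → ℕ) (hm : ∀ i, (m i : ℝ) < k * side (item i)) :
    ∑ i, m i ^ 2 ≤ (k - 1) ^ 2 := by
  obtain ⟨pos, hin, hdis⟩ := h
  have hin' := fun i => (square_subset_unit_iff (side_pos (item i)).le).1 (hin i)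
  -- In each coordinate, the `m i` consecutive integers after the floor of `k * x` lie strictly
  -- inside the scaled interval, since `m i < k * side`.
  let G : ι → Finset (ℤ × ℤ) := fun i =>
    Finset.Icc (⌊k * (pos i).1⌋ + 1) (⌊k * (pos i).1⌋ + m i) ×ˢ
      Finset.Icc (⌊k * (pos i).2⌋ + 1) (⌊k * (pos i).2⌋ + m i)
  have key : ∀ (x s : ℝ) (m : ℕ) (a : ℤ), (m : ℝ) < k * s → a ∈ Finset.Icc (⌊k * x⌋ + 1) (⌊k * x⌋ + m) →
      k * x < a ∧ (a : ℝ) < k * (x + s) := by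
    intro x s m a hms ha
    rw [Finset.mem_Icc] at ha
    have h1 := Int.lt_floor_add_one (k * x : ℝ)
    have h2 := Int.floor_le (k * x : ℝ)
    have h3 : ((⌊k * x⌋ : ℤ) : ℝ) + 1 ≤ a := by exact_mod_cast ha.1
    have h4 : (a : ℝ) ≤ (⌊k * x⌋ : ℤ) + m := by exact_mod_cast ha.2
    constructor
    · linarith
    · nlinarith
  have hcard : ∀ i, (G i).card = m i ^ 2 := by
    intro i
    simp [G, Finset.card_product, sq]
  have hdisj : ∀ i j, i ≠ j → Disjoint (G i) (G j) := by
    intro i j hij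
    rw [Finset.disjoint_left]
    rintro ⟨a, b⟩ hi hj
    simp only [G, Finset.mem_product] at hi hj
    have hk : (0 : ℝ) < k := by
      rcases Nat.eq_zero_or_pos k with rfl | hk
      · have := hm i
        simp only [Nat.cast_zero, zero_mul] at this
        exact absurd this (not_lt.2 (Nat.cast_nonneg _))
      · exact_mod_cast hk
    have e1 := key _ _ _ _ (hm i) hi.1
    have e2 := key _ _ _ _ (hm i) hi.2
    have e3 := key _ _ _ _ (hm j) hj.1
    have e4 := key _ _ _ _ (hm j) hj.2
    have hd : Disjoint (interior (square (pos i) ((item i : ℚ) : ℝ)))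
      (interior (square (pos j) ((item j : ℚ) : ℝ))) := hdis hij
    have hd := Set.disjoint_left.1 hd
    -- A common grid point would lie in both open squares.
    refine @hd ((a : ℝ) / k, (b : ℝ) / k) ?_ ?_ <;>
    · rw [interior_square]
      simp only [Set.mem_prod, Set.mem_Ioo, lt_div_iff₀ hk, div_lt_iff₀ hk]
      unfold side at *
      refine ⟨⟨?_, ?_⟩, ?_, ?_⟩ <;> linarith
  have hsub : Finset.univ.biUnion G ⊆
      Finset.Icc (1 : ℤ) (k - 1) ×ˢ Finset.Icc (1 : ℤ) (k - 1) := by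
    rintro ⟨a, b⟩ hab
    simp only [Finset.mem_biUnion, Finset.mem_univ, true_and, G, Finset.mem_product] at hab
    obtain ⟨i, ha, hb⟩ := hab
    have aux : ∀ (x : ℝ) (a : ℤ), 0 ≤ x → x + side (item i) ≤ 1 → k * x < a →
        (a : ℝ) < k * (x + side (item i)) → a ∈ Finset.Icc (1 : ℤ) (k - 1) := by
      intro x a h0 h1 h2 h3
      have hk : (0 : ℝ) ≤ k := Nat.cast_nonneg k
      have h4 : (0 : ℝ) < a := lt_of_le_of_lt (mul_nonneg hk h0) h2
      have h5 : (a : ℝ) < k := lt_of_lt_of_le h3 (by nlinarith)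
      have h6 : 0 < a := by exact_mod_cast h4
      have h7 : a < k := by exact_mod_cast h5
      rw [Finset.mem_Icc]
      omega
    have e1 := key _ _ _ _ (hm i) ha
    have e2 := key _ _ _ _ (hm i) hb
    rw [Finset.mem_product]
    exact ⟨aux _ _ (hin' i).1.1 (hin' i).1.2 e1.1 e1.2,
      aux _ _ (hin' i).2.1 (hin' i).2.2 e2.1 e2.2⟩
  calc ∑ i, m i ^ 2 = ∑ i, (G i).card := by simp [hcard]
    _ = (Finset.univ.biUnion G).card := by
        rw [Finset.card_biUnion]
        exact fun i _ j _ hij => hdisj i j hij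
    _ ≤ _ := Finset.card_le_card hsub
    _ = (k - 1) ^ 2 := by
        rw [Finset.card_product, Int.card_Icc, sq]
        have : ((k : ℤ) - 1 + 1 - 1).toNat = k - 1 := by omega
        rw [this]

/-- Two squares that share a bin have total side length at most one. -/
lemma Fits.side_add_le {ι : Type} {item : ι → Item} (h : Fits item) {i j : ι} (hij : i ≠ j) :
    side (item i) + side (item j) ≤ 1 := by
  obtain ⟨pos, hin, hdis⟩ := h
  have hin' := fun i => (square_subset_unit_iff (side_pos (item i)).le).1 (hin i)
  have h : Disjoint (interior (square (pos i) ((item i : ℚ) : ℝ)))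
      (interior (square (pos j) ((item j : ℚ) : ℝ))) := hdis hij
  rw [interior_square, interior_square, Set.disjoint_prod] at h
  obtain ⟨⟨a1, a2⟩, a3, a4⟩ := hin' i
  obtain ⟨⟨b1, b2⟩, b3, b4⟩ := hin' j
  have si := side_pos (item i)
  have sj := side_pos (item j)
  unfold side at *
  rcases h with h | h
  all_goals
    rw [Set.Ioo_disjoint_Ioo, min_le_iff, le_max_iff, le_max_iff] at h
    rcases h with (h | h) | (h | h) <;> linarith

/-! ### Building packings of rectangles by juxtaposition. -/

/-- Two placed squares are separated by an axis-parallel line. -/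
def Separated (e e' : (ℝ × ℝ) × Item) : Prop :=
  e.1.1 + side e.2 ≤ e'.1.1 ∨ e'.1.1 + side e'.2 ≤ e.1.1 ∨
    e.1.2 + side e.2 ≤ e'.1.2 ∨ e'.1.2 + side e'.2 ≤ e.1.2

lemma Separated.symm {e e' : (ℝ × ℝ) × Item} (h : Separated e e') : Separated e' e := by
  unfold Separated at *
  tauto

/-- The placed square `e` lies in the rectangle `[0, w] × [0, h]`. -/
def Inside (w h : ℝ) (e : (ℝ × ℝ) × Item) : Prop :=
  (0 ≤ e.1.1 ∧ e.1.1 + side e.2 ≤ w) ∧ (0 ≤ e.1.2 ∧ e.1.2 + side e.2 ≤ h)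

/-- The items of `m` can be packed into a rectangle of width `w` and height `h`. -/
def Packs (w h : ℝ) (m : Multiset Item) : Prop :=
  ∃ L : List ((ℝ × ℝ) × Item), (L.map Prod.snd : Multiset Item) = m ∧
    (∀ e ∈ L, Inside w h e) ∧ L.Pairwise Separated

namespace Packs

variable {w h w' h' : ℝ} {m m' : Multiset Item}

lemma empty (w h : ℝ) : Packs w h 0 := ⟨[], by simp⟩

lemma mono (hm : Packs w h m) (hw : w ≤ w') (hh : h ≤ h') : Packs w' h' m := by
  obtain ⟨L, h1, h2, h3⟩ := hm
  refine ⟨L, h1, fun e he => ?_, h3⟩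
  obtain ⟨⟨a, b⟩, c, d⟩ := h2 e he
  exact ⟨⟨a, b.trans hw⟩, c, d.trans hh⟩

lemma singleton {s : Item} (hw : side s ≤ w) (hh : side s ≤ h) : Packs w h {s} :=
  ⟨[((0, 0), s)], by simp, by simp [Inside, hw, hh], by simp⟩

lemma beside (hm : Packs w h m) (hm' : Packs w' h m') (hw : 0 ≤ w) (hw' : 0 ≤ w') :
    Packs (w + w') h (m + m') := by
  obtain ⟨L, h1, h2, h3⟩ := hm
  obtain ⟨L', h1', h2', h3'⟩ := hm'
  refine ⟨L ++ L'.map fun e => ((e.1.1 + w, e.1.2), e.2), ?_, ?_, ?_⟩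
  · rw [← h1, ← h1', List.map_append, List.map_map, ← Multiset.coe_add]
    rfl
  · intro e he
    rw [List.mem_append, List.mem_map] at he
    rcases he with he | ⟨e, he, rfl⟩
    · obtain ⟨⟨a, b⟩, c⟩ := h2 e he
      exact ⟨⟨a, by linarith⟩, c⟩
    · obtain ⟨⟨a, b⟩, c⟩ := h2' e he
      exact ⟨⟨by simp only; linarith, by simp only; linarith⟩, c⟩
  · rw [List.pairwise_append]
    refine ⟨h3, ?_, ?_⟩
    · rw [List.pairwise_map]
      refine h3'.imp ?_
      intro e e' hs
      simp only [Separated] at *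
      rcases hs with hs | hs | hs | hs
      · left; linarith
      · right; left; linarith
      · right; right; left; exact hs
      · right; right; right; exact hs
    · intro e he e' he'
      rw [List.mem_map] at he'
      obtain ⟨e', he', rfl⟩ := he'
      left
      have := (h2 e he).1.2
      have := (h2' e' he').1.1
      simp only
      linarith

lemma transpose (hm : Packs w h m) : Packs h w m := by
  obtain ⟨L, h1, h2, h3⟩ := hm
  refine ⟨L.map fun e => ((e.1.2, e.1.1), e.2), ?_, ?_, ?_⟩
  · rw [← h1, List.map_map]
    rfl
  · intro e he
    rw [List.mem_map] at he
    obtain ⟨e, he, rfl⟩ := he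
    exact ⟨(h2 e he).2, (h2 e he).1⟩
  · rw [List.pairwise_map]
    refine h3.imp ?_
    intro e e' hs
    unfold Separated at *
    simp only
    tauto

lemma above (hm : Packs w h m) (hm' : Packs w h' m') (hh : 0 ≤ h) (hh' : 0 ≤ h') :
    Packs w (h + h') (m + m') :=
  (hm.transpose.beside hm'.transpose hh hh').transpose

/-- Items of side at most `s` are packed into a row. -/
lemma row {s : ℝ} (hs : 0 ≤ s) : ∀ (k : ℕ) (m : Multiset Item), (∀ x ∈ m, side x ≤ s) →
    m.card ≤ k → Packs (k * s) s m := by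
  intro k
  induction k with
  | zero =>
    intro m _ hc
    rw [Nat.le_zero, Multiset.card_eq_zero] at hc
    subst hc
    exact empty _ _
  | succ k ih =>
    intro m hm hc
    rcases m.empty_or_exists_mem with rfl | ⟨x, hx⟩
    · exact empty _ _
    · obtain ⟨m', rfl⟩ := Multiset.exists_cons_of_mem hx
      rw [Multiset.card_cons] at hc
      have h1 := ih m' (fun y hy => hm y (Multiset.mem_cons_of_mem hy)) (by omega)
      have h2 : Packs s s {x} := singleton (hm x hx) (hm x hx)
      have h3 := h2.beside h1 hs (by positivity)
      rw [Multiset.singleton_add] at h3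
      exact h3.mono (by push_cast; linarith) le_rfl

end Packs

lemma exists_split (m : Multiset Item) {a b : ℕ} (h : m.card ≤ a + b) :
    ∃ m₁ m₂ : Multiset Item, m = m₁ + m₂ ∧ m₁.card ≤ a ∧ m₂.card ≤ b := by
  induction m using Quotient.inductionOn with
  | _ l =>
    refine ⟨(l.take a : List Item), (l.drop a : List Item), ?_, ?_, ?_⟩
    · rw [Multiset.coe_add, List.take_append_drop]
      rfl
    · simp
    · simp only [Multiset.quot_mk_to_coe, Multiset.coe_card] at h
      simp only [Multiset.coe_card, List.length_drop]
      omega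

/-- Items of side at most `s` are packed into a grid. -/
lemma Packs.grid {s : ℝ} (hs : 0 ≤ s) (a : ℕ) : ∀ (b : ℕ) (m : Multiset Item),
    (∀ x ∈ m, side x ≤ s) → m.card ≤ a * b → Packs (a * s) (b * s) m := by
  intro b
  induction b with
  | zero =>
    intro m _ hc
    rw [Nat.mul_zero, Nat.le_zero, Multiset.card_eq_zero] at hc
    subst hc
    exact Packs.empty _ _
  | succ b ih =>
    intro m hm hc
    obtain ⟨m₁, m₂, rfl, h1, h2⟩ := exists_split m (a := a) (b := a * b) (by
      rw [Nat.mul_succ] at hc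
      omega)
    have e1 := Packs.row hs a m₁ (fun x hx => hm x (Multiset.mem_add.2 (Or.inl hx))) h1
    have e2 := ih m₂ (fun x hx => hm x (Multiset.mem_add.2 (Or.inr hx))) h2
    exact (e1.above e2 hs (by positivity)).mono le_rfl (by push_cast; linarith)

/-! ### Packings into several bins as upper bounds on the optimum. -/

/-- The items of `m` can be packed into `k` bins. -/
def PackIn (k : ℕ) (m : Multiset Item) : Prop :=
  ∃ D : List (ℕ × (ℝ × ℝ) × Item), (D.map (fun e => e.2.2) : Multiset Item) = m ∧
    (∀ e ∈ D, e.1 < k ∧ Inside 1 1 e.2) ∧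
    D.Pairwise fun e e' => e.1 = e'.1 → Separated e.2 e'.2

lemma PackIn.empty (k : ℕ) : PackIn k 0 := ⟨[], by simp⟩

lemma PackIn.add_bin {k : ℕ} {m m' : Multiset Item} (h : PackIn k m) (h' : Packs 1 1 m') :
    PackIn (k + 1) (m' + m) := by
  obtain ⟨D, h1, h2, h3⟩ := h
  obtain ⟨L, h1', h2', h3'⟩ := h'
  refine ⟨L.map (fun e => (k, e)) ++ D, ?_, ?_, ?_⟩
  · rw [← h1, ← h1', List.map_append, List.map_map, ← Multiset.coe_add]
    rfl
  · intro e he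
    rw [List.mem_append, List.mem_map] at he
    rcases he with ⟨e, he, rfl⟩ | he
    · exact ⟨Nat.lt_succ_self k, h2' e he⟩
    · exact ⟨(h2 e he).1.trans (Nat.lt_succ_self k), (h2 e he).2⟩
  · rw [List.pairwise_append]
    refine ⟨?_, h3, ?_⟩
    · rw [List.pairwise_map]
      exact h3'.imp (S := fun a b => (k, a).1 = (k, b).1 → Separated (k, a).2 (k, b).2)
        fun hs _ => hs
    · intro e he e' he' hee
      rw [List.mem_map] at he
      obtain ⟨e, he, rfl⟩ := he
      exact absurd hee (h2 e' he').1.ne'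

lemma PackIn.add {k k' : ℕ} {m m' : Multiset Item} (h : PackIn k m) (h' : PackIn k' m') :
    PackIn (k + k') (m + m') := by
  obtain ⟨D, h1, h2, h3⟩ := h
  obtain ⟨D', h1', h2', h3'⟩ := h'
  refine ⟨D ++ D'.map (fun e => (k + e.1, e.2)), ?_, ?_, ?_⟩
  · rw [← h1, ← h1', List.map_append, List.map_map, ← Multiset.coe_add]
    rfl
  · intro e he
    rw [List.mem_append, List.mem_map] at he
    rcases he with he | ⟨e, he, rfl⟩
    · exact ⟨by have := (h2 e he).1; omega, (h2 e he).2⟩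
    · exact ⟨by have := (h2' e he).1; simp only; omega, (h2' e he).2⟩
  · rw [List.pairwise_append]
    refine ⟨h3, ?_, ?_⟩
    · rw [List.pairwise_map]
      exact h3'.imp fun hs hee => hs (by simp only at hee; omega)
    · intro e he e' he' hee
      rw [List.mem_map] at he'
      obtain ⟨e', he', rfl⟩ := he'
      have := (h2 e he).1
      simp only at hee
      omega

/-- Packings are built as multisets, whereas `opt` concerns an ordered input; this puts the
placements into the input order. -/
lemma exists_perm_map_eq {α β : Type} (g : α → β) {l l' : List β} (h : l.Perm l') :
    ∀ D : List α, D.map g = l → ∃ D' : List α, D.Perm D' ∧ D'.map g = l' := by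
  induction h with
  | nil => exact fun D hD => ⟨D, List.Perm.refl D, hD⟩
  | cons x _ ih =>
    intro D hD
    obtain ⟨a, D, rfl, rfl, hD₁⟩ := List.map_eq_cons_iff.1 hD
    obtain ⟨D', h1, h2⟩ := ih D hD₁
    exact ⟨a :: D', h1.cons a, by simp [h2]⟩
  | swap x y l =>
    intro D hD
    obtain ⟨a, D, rfl, rfl, hD₁⟩ := List.map_eq_cons_iff.1 hD
    obtain ⟨b, D, rfl, rfl, hD₂⟩ := List.map_eq_cons_iff.1 hD₁
    exact ⟨b :: a :: D, List.Perm.swap b a D, by simp [hD₂]⟩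
  | trans _ _ ih1 ih2 =>
    intro D hD
    obtain ⟨D', h1, h2⟩ := ih1 D hD
    obtain ⟨D'', h3, h4⟩ := ih2 D' h2
    exact ⟨D'', h1.trans h3, h4⟩

lemma PackIn.opt_le {k : ℕ} {I : List Item} (h : PackIn k (I : Multiset Item)) : opt I ≤ k := by
  obtain ⟨D, h1, h2, h3⟩ := h
  obtain ⟨D', hp, rfl⟩ := exists_perm_map_eq (fun e => e.2.2) (Multiset.coe_eq_coe.1 h1) D rfl
  have h2' : ∀ e ∈ D', e.1 < k ∧ Inside 1 1 e.2 := fun e he => h2 e (hp.mem_iff.2 he)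
  have h3' := (hp.pairwise_iff (R := fun e e' => e.1 = e'.1 → Separated e.2 e'.2)
    (fun hs hee => (hs hee.symm).symm)).1 h3
  have hlen : (D'.map fun e => e.2.2).length = D'.length := List.length_map _
  let f : Fin (D'.map fun e => e.2.2).length → ℕ := fun i => (D'.get (i.cast hlen)).1
  have hf : IsPacking (D'.map fun e => e.2.2) f := by
    intro b
    refine ⟨fun i => (D'.get (i.1.cast hlen)).2.1, ?_, ?_⟩
    · intro i
      have h := (h2' (D'.get (i.1.cast hlen)) (List.get_mem _ _)).2
      have e : (D'.map fun e => e.2.2).get i.1 = (D'.get (i.1.cast hlen)).2.2 := by simp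
      simp only [e]
      exact (square_subset_unit_iff (side_pos _).le).2 h
    · intro i j hij
      have hne : i.1.cast hlen ≠ j.1.cast hlen := by
        intro h
        exact hij (Subtype.ext (Fin.cast_injective _ h))
      have hsep : Separated (D'.get (i.1.cast hlen)).2 (D'.get (j.1.cast hlen)).2 := by
        have hb : (D'.get (i.1.cast hlen)).1 = (D'.get (j.1.cast hlen)).1 := i.2.trans j.2.symm
        rw [List.pairwise_iff_get] at h3'
        rcases lt_or_gt_of_ne hne with hlt | hlt
        · exact h3' _ _ hlt hb
        · exact (h3' _ _ hlt hb.symm).symm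
      have ei : (D'.map fun e => e.2.2).get i.1 = (D'.get (i.1.cast hlen)).2.2 := by simp
      have ej : (D'.map fun e => e.2.2).get j.1 = (D'.get (j.1.cast hlen)).2.2 := by simp
      simp only [ei, ej]
      rw [interior_square, interior_square, Set.disjoint_prod, Set.Ioo_disjoint_Ioo,
        Set.Ioo_disjoint_Ioo, min_le_iff, le_max_iff, le_max_iff, min_le_iff, le_max_iff,
        le_max_iff]
      unfold Separated side at hsep
      tauto
  refine (Nat.sInf_le ⟨f, hf, rfl⟩ : opt _ ≤ numBins f).trans ?_
  have : Finset.univ.image f ⊆ Finset.range k := by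
    intro b hb
    obtain ⟨i, -, rfl⟩ := Finset.mem_image.1 hb
    exact Finset.mem_range.2 (h2' _ (List.get_mem _ _)).1
  simpa [numBins] using Finset.card_le_card this

/-- Items of four classes are packed greedily into bins with fixed capacities per class. -/
lemma PackIn.of_caps {P₁ P₂ P₃ P₄ : Item → Prop} {c₁ c₂ c₃ c₄ : ℕ}
    (hcap : ∀ m₁ m₂ m₃ m₄ : Multiset Item, (∀ x ∈ m₁, P₁ x) → (∀ x ∈ m₂, P₂ x) →
      (∀ x ∈ m₃, P₃ x) → (∀ x ∈ m₄, P₄ x) → m₁.card ≤ c₁ → m₂.card ≤ c₂ → m₃.card ≤ c₃ →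
      m₄.card ≤ c₄ → Packs 1 1 (m₁ + m₂ + m₃ + m₄)) :
    ∀ (k : ℕ) (m₁ m₂ m₃ m₄ : Multiset Item), (∀ x ∈ m₁, P₁ x) → (∀ x ∈ m₂, P₂ x) →
      (∀ x ∈ m₃, P₃ x) → (∀ x ∈ m₄, P₄ x) → m₁.card ≤ c₁ * k → m₂.card ≤ c₂ * k →
      m₃.card ≤ c₃ * k → m₄.card ≤ c₄ * k → PackIn k (m₁ + m₂ + m₃ + m₄) := by
  intro k
  induction k with
  | zero =>
    intro m₁ m₂ m₃ m₄ _ _ _ _ h1 h2 h3 h4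
    simp only [Nat.mul_zero, Nat.le_zero, Multiset.card_eq_zero] at h1 h2 h3 h4
    subst h1 h2 h3 h4
    exact PackIn.empty 0
  | succ k ih =>
    intro m₁ m₂ m₃ m₄ p1 p2 p3 p4 h1 h2 h3 h4
    rw [Nat.mul_succ, Nat.add_comm] at h1 h2 h3 h4
    obtain ⟨a₁, b₁, rfl, h1, h1'⟩ := exists_split m₁ h1
    obtain ⟨a₂, b₂, rfl, h2, h2'⟩ := exists_split m₂ h2
    obtain ⟨a₃, b₃, rfl, h3, h3'⟩ := exists_split m₃ h3
    obtain ⟨a₄, b₄, rfl, h4, h4'⟩ := exists_split m₄ h4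
    simp only [Multiset.mem_add, or_imp, forall_and] at p1 p2 p3 p4
    have e := (ih b₁ b₂ b₃ b₄ p1.2 p2.2 p3.2 p4.2 h1' h2' h3' h4').add_bin
      (hcap a₁ a₂ a₃ a₄ p1.1 p2.1 p3.1 p4.1 h1 h2 h3 h4)
    have : a₁ + b₁ + (a₂ + b₂) + (a₃ + b₃) + (a₄ + b₄) =
      a₁ + a₂ + a₃ + a₄ + (b₁ + b₂ + b₃ + b₄) := by abel
    rwa [this]

/-! ### Grid points covered in the bins of an online run. -/

/-- The largest natural number `m` with `m / k < side s`. -/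
noncomputable def gridSide (k : ℕ) (s : Item) : ℕ := ⌈(k : ℝ) * side s⌉₊ - 1

lemma gridSide_lt {k : ℕ} (hk : 0 < k) (s : Item) : (gridSide k s : ℝ) < k * side s := by
  have h : (0 : ℝ) < k * side s := mul_pos (by exact_mod_cast hk) (side_pos s)
  have h1 := Nat.ceil_pos.2 h
  have h2 := Nat.ceil_lt_add_one h.le
  rw [gridSide, Nat.cast_sub h1]
  push_cast
  linarith

lemma le_gridSide {k m : ℕ} {s : Item} (h : (m : ℝ) < k * side s) : m ≤ gridSide k s := by
  have := Nat.lt_ceil.2 h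
  rw [gridSide]
  omega

lemma sq_le_gridSide_sq {k m : ℕ} {s : Item} (h : (m : ℝ) < k * side s) :
    m ^ 2 ≤ gridSide k s ^ 2 :=
  Nat.pow_le_pow_left (le_gridSide h) 2

namespace OnlineAlgorithm

variable (A : OnlineAlgorithm)

/-- The items of `rest`, presented after `past`, together with their bins. -/
def trace : List Item → List Item → List (ℕ × Item)
  | _, [] => []
  | past, s :: rest => (A.bin past s, s) :: trace (past ++ [s]) rest

lemma trace_append (past l l' : List Item) :
    A.trace past (l ++ l') = A.trace past l ++ A.trace (past ++ l) l' := by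
  induction l generalizing past with
  | nil => simp [trace]
  | cons s l ih => simp [trace, ih]

lemma trace_map_snd (past l : List Item) : (A.trace past l).map Prod.snd = l := by
  induction l generalizing past with
  | nil => rfl
  | cons s l ih => simp [trace, ih]

lemma trace_length (past l : List Item) : (A.trace past l).length = l.length := by
  rw [← List.length_map (f := Prod.snd), trace_map_snd]

lemma trace_eq_ofFn (past l : List Item) : A.trace past l =
    List.ofFn fun i : Fin l.length => (A.bin (past ++ l.take i) (l.get i), l.get i) := by
  induction l generalizing past with
  | nil => rfl
  | cons s l ih =>
    rw [trace, ih]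
    simp [List.ofFn_succ]

/-- The bins used for `rest`, presented after `past`. -/
def bins (past l : List Item) : Finset ℕ := ((A.trace past l).map Prod.fst).toFinset

lemma bins_append (past l l' : List Item) :
    A.bins past (l ++ l') = A.bins past l ∪ A.bins (past ++ l) l' := by
  simp [bins, trace_append]

lemma cost_eq (I : List Item) : A.cost I = (A.bins [] I).card := by
  rw [cost, numBins, bins, trace_eq_ofFn]
  congr 1
  ext b
  simp [List.mem_ofFn]

/-- This is `Fits.sum_sq_le` as a sum over the trace, a list that splits along the phases of the
input. -/
lemma sum_gridSide_sq_le (I : List Item) (b : ℕ) {k : ℕ} (hk : 0 < k) :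
    (((A.trace [] I).filter (fun e => e.1 = b)).map fun e => gridSide k e.2 ^ 2).sum
      ≤ (k - 1) ^ 2 := by
  have h := (A.isPacking I b).sum_sq_le k (fun i => gridSide k (I.get i.1))
    fun i => gridSide_lt hk _
  refine le_trans (le_of_eq ?_) h
  have e : ∀ l : List (ℕ × Item), ((l.filter (fun e => e.1 = b)).map
      fun e => gridSide k e.2 ^ 2).sum =
      (l.map fun e => if e.1 = b then gridSide k e.2 ^ 2 else 0).sum := by
    intro l
    induction l with
    | nil => rfl
    | cons e l ih => by_cases h : e.1 = b <;> simp [h, ih]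
  rw [e, trace_eq_ofFn, List.map_ofFn, List.sum_ofFn]
  simp only [Function.comp_def, List.nil_append]
  rw [← Finset.sum_filter]
  exact Finset.sum_subtype _ (by simp) (fun i => gridSide k (I.get i) ^ 2)

lemma pairwise_side_add_le (I : List Item) : (A.trace [] I).Pairwise fun e e' =>
    e.1 = e'.1 → side e.2 + side e'.2 ≤ 1 := by
  rw [trace_eq_ofFn, List.pairwise_ofFn]
  intro i j hij hb
  refine (A.isPacking I _).side_add_le (i := ⟨i, hb⟩) (j := ⟨j, rfl⟩) ?_
  intro h
  rw [Subtype.mk.injEq] at h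
  exact hij.ne h

end OnlineAlgorithm

/-- A lower bound on the optimal cost when all items of an initial segment are larger than
`1 / k`. -/
lemma length_le_mul_opt (A : OnlineAlgorithm) {l l' : List Item} {k : ℕ}
    (hl : ∀ s ∈ l, 1 < k * side s) : l.length ≤ (k - 1) ^ 2 * opt (l ++ l') := by
  -- The infimum is attained because `A` itself supplies a packing.
  obtain ⟨f, hf, hk⟩ := Nat.sInf_mem (s := {k : ℕ | ∃ f : Fin (l ++ l').length → ℕ,
    IsPacking (l ++ l') f ∧ numBins f = k}) ⟨_, _, A.isPacking _, rfl⟩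
  rw [opt, ← hk, numBins]
  let m : Fin (l ++ l').length → ℕ := fun i => if (i : ℕ) < l.length then 1 else 0
  -- For empty `l` nothing excludes `k = 0`, so that case is set apart.
  have hm : ∀ i, (m i : ℝ) < k * side ((l ++ l').get i) ∨ l = [] := by
    intro i
    by_cases hnil : l = []
    · exact Or.inr hnil
    left
    obtain ⟨s, hs⟩ := List.exists_mem_of_ne_nil l hnil
    have hkp : (0 : ℝ) < k := by
      by_contra h
      have := hl s hs
      have := side_pos s
      nlinarith
    by_cases hi : (i : ℕ) < l.length
    · simp only [m, hi, if_true, Nat.cast_one, List.get_eq_getElem, List.getElem_append_left]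
      exact hl _ (List.getElem_mem _)
    · simp only [m, hi, if_false, Nat.cast_zero]
      exact mul_pos hkp (side_pos _)
  rcases eq_or_ne l [] with hnil | hnil
  · simp [hnil]
  have h1 : ∀ b ∈ Finset.univ.image f, ∑ i ∈ Finset.univ.filter (fun i => f i = b), m i
      ≤ (k - 1) ^ 2 := by
    intro b _
    have := (hf b).sum_sq_le k (fun i => m i.1) (fun i => (hm i.1).resolve_right hnil)
    refine le_trans (le_of_eq ?_) this
    rw [Finset.sum_subtype (Finset.univ.filter fun i => f i = b) (p := fun i => f i = b) (by simp)]
    refine Finset.sum_congr rfl fun i _ => ?_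
    simp only [m]
    split_ifs <;> rfl
  have h2 : ∑ i, m i = l.length := by
    simp only [m]
    rw [Finset.sum_boole, Nat.cast_id, ← Fintype.card_subtype]
    have : Fintype.card {i : Fin (l ++ l').length // (i : ℕ) < l.length} =
        Fintype.card (Fin l.length) := Fintype.card_congr
      { toFun := fun i => ⟨i.1, i.2⟩
        invFun := fun i => ⟨⟨i, by simp; omega⟩, i.2⟩
        left_inv := fun i => rfl
        right_inv := fun i => rfl }
    rw [this, Fintype.card_fin]
  calc l.length = ∑ i, m i := h2.symm
    _ = ∑ b ∈ Finset.univ.image f, ∑ i ∈ Finset.univ.filter (fun i => f i = b), m i :=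
        (Finset.sum_fiberwise_of_maps_to (fun i _ => Finset.mem_image_of_mem f (Finset.mem_univ i))
          _).symm
    _ ≤ ∑ b ∈ Finset.univ.image f, (k - 1) ^ 2 := Finset.sum_le_sum h1
    _ = _ := by rw [Finset.sum_const, smul_eq_mul, Nat.mul_comm]

/-! ### Explicit layouts of one bin and their repetition. -/

lemma Packs.block {s w h : ℝ} (hs : 0 ≤ s) (a b : ℕ) {m : Multiset Item} (hm : ∀ x ∈ m, side x ≤ s)
    (hc : m.card ≤ a * b) (hw : a * s ≤ w) (hh : b * s ≤ h) : Packs w h m :=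
  (Packs.grid hs a b m hm hc).mono hw hh

/-- A large square in a corner, three squares of side about `1 / 3`, two of side about `1 / 4` and
six small ones. -/
lemma packs_corner_thirds {σ : ℝ} (h1 : 1 / 3 ≤ σ) (h2 : σ ≤ 3334 / 10000)
    (u t q n : Multiset Item) (hu : ∀ x ∈ u, side x ≤ 1 - σ) (ht : ∀ x ∈ t, side x ≤ σ)
    (hq : ∀ x ∈ q, side x ≤ 2501 / 10000) (hn : ∀ x ∈ n, side x ≤ 2 / 25)
    (cu : u.card ≤ 1) (ct : t.card ≤ 3) (cq : q.card ≤ 2) (cn : n.card ≤ 6) :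
    Packs 1 1 (u + t + q + n) := by
  obtain ⟨t₁, t₂, rfl, ct₁, ct₂⟩ := exists_split t (a := 1) (b := 2) ct
  obtain ⟨q₁, q₂, rfl, cq₁, cq₂⟩ := exists_split q (a := 1) (b := 1) cq
  obtain ⟨n₁, n₂, rfl, cn₁, cn₂⟩ := exists_split n (a := 3) (b := 3) cn
  simp only [Multiset.mem_add, or_imp, forall_and] at ht hq hn
  have bu : Packs (1 - σ) (1 - σ) u :=
    Packs.block (s := 1 - σ) (by linarith) 1 1 hu cu (by norm_num) (by norm_num)
  have bt₁ : Packs σ σ t₁ := Packs.block (s := σ) (by linarith) 1 1 ht.1 ct₁ (by norm_num) (by norm_num)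
  have bt₂ : Packs (2 * σ) σ t₂ :=
    Packs.block (s := σ) (by linarith) 2 1 ht.2 ct₂ (by norm_num) (by norm_num)
  have bq₁ : Packs σ (2501 / 10000) q₁ :=
    Packs.block (by norm_num) 1 1 hq.1 cq₁ (by push_cast; linarith) (by norm_num)
  have bq₂ : Packs (2501 / 10000) σ q₂ :=
    Packs.block (by norm_num) 1 1 hq.2 cq₂ (by norm_num) (by push_cast; linarith)
  have bn₁ : Packs σ (2 / 25) n₁ :=
    Packs.block (by norm_num) 3 1 hn.1 cn₁ (by push_cast; linarith) (by norm_num)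
  have bn₂ : Packs (2 / 25) σ n₂ :=
    Packs.block (by norm_num) 1 3 hn.2 cn₂ (by norm_num) (by push_cast; linarith)
  -- The L-shape around the corner square is cut into a right strip of width `σ` and a full-width
  -- top strip of height `σ`.
  have right := (((bt₁.above bq₁ (by linarith) (by norm_num)).above bn₁ (by linarith)
    (by norm_num)).mono (h' := 1 - σ) le_rfl (by linarith))
  have top := (((bt₂.beside bq₂ (by linarith) (by norm_num)).beside bn₂ (by linarith)
    (by norm_num)).mono (w' := 1) (by linarith) le_rfl)
  have all := (((bu.beside right (by linarith) (by linarith)).mono (w' := 1) (by linarith)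
    le_rfl).above top (by linarith) (by linarith)).mono (h' := 1) le_rfl (by linarith)
  convert all using 1
  abel

/-- A large square in a corner, five squares of side about `1 / 4` and fifteen small ones. -/
lemma packs_corner_quarters {σ : ℝ} (h1 : 1 / 4 ≤ σ) (h2 : σ ≤ 2501 / 10000)
    (u q n : Multiset Item) (hu : ∀ x ∈ u, side x ≤ 1 - σ) (hq : ∀ x ∈ q, side x ≤ σ)
    (hn : ∀ x ∈ n, side x ≤ 2 / 25)
    (cu : u.card ≤ 1) (cq : q.card ≤ 5) (cn : n.card ≤ 15) :
    Packs 1 1 (u + q + n) := by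
  obtain ⟨q₁, q₂, rfl, cq₁, cq₂⟩ := exists_split q (a := 2) (b := 3) cq
  obtain ⟨n₁, n₂, rfl, cn₁, cn₂⟩ := exists_split n (a := 6) (b := 9) cn
  simp only [Multiset.mem_add, or_imp, forall_and] at hq hn
  have bu : Packs (1 - σ) (1 - σ) u :=
    Packs.block (s := 1 - σ) (by linarith) 1 1 hu cu (by norm_num) (by norm_num)
  have bq₁ : Packs σ (2 * σ) q₁ :=
    Packs.block (s := σ) (by linarith) 1 2 hq.1 cq₁ (by norm_num) (by norm_num)
  have bq₂ : Packs (3 * σ) σ q₂ :=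
    Packs.block (s := σ) (by linarith) 3 1 hq.2 cq₂ (by norm_num) (by norm_num)
  have bn₁ : Packs σ (4 / 25) n₁ :=
    Packs.block (by norm_num) 3 2 hn.1 cn₁ (by push_cast; linarith) (by norm_num)
  have bn₂ : Packs (6 / 25) σ n₂ :=
    Packs.block (by norm_num) 3 3 hn.2 cn₂ (by norm_num) (by push_cast; linarith)
  have right := (bq₁.above bn₁ (by linarith) (by norm_num)).mono (h' := 1 - σ) le_rfl (by linarith)
  have top := (bq₂.beside bn₂ (by linarith) (by norm_num)).mono (w' := 1) (by linarith) le_rfl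
  have all := (((bu.beside right (by linarith) (by linarith)).mono (w' := 1) (by linarith)
    le_rfl).above top (by linarith) (by linarith)).mono (h' := 1) le_rfl (by linarith)
  convert all using 1
  abel

/-- A 3 by 3 block leaves a strip of width 0.2497, enough for three columns of side 0.08. -/
lemma packs_quarters (q n : Multiset Item) (hq : ∀ x ∈ q, side x ≤ 2501 / 10000)
    (hn : ∀ x ∈ n, side x ≤ 2 / 25) (cq : q.card ≤ 9) (cn : n.card ≤ 27) :
    Packs 1 1 (q + n) := by
  have bq : Packs (7503 / 10000) 1 q :=
    Packs.block (by norm_num) 3 3 hq cq (by norm_num) (by norm_num)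
  have bn : Packs (6 / 25) 1 n :=
    Packs.block (by norm_num) 3 12 hn (by omega) (by norm_num) (by norm_num)
  exact (bq.beside bn (by norm_num) (by norm_num)).mono (by norm_num) le_rfl

/-- Beside a 2 by 2 block stand a column of two quarters and a column of small squares; the third
quarter lies on top. -/
lemma packs_thirds (t q n : Multiset Item) (ht : ∀ x ∈ t, side x ≤ 3334 / 10000)
    (hq : ∀ x ∈ q, side x ≤ 2501 / 10000) (hn : ∀ x ∈ n, side x ≤ 2 / 25)
    (ct : t.card ≤ 4) (cq : q.card ≤ 3) (cn : n.card ≤ 8) :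
    Packs 1 1 (t + q + n) := by
  obtain ⟨q₁, q₂, rfl, cq₁, cq₂⟩ := exists_split q (a := 2) (b := 1) cq
  simp only [Multiset.mem_add, or_imp, forall_and] at hq
  have bt : Packs (6668 / 10000) (6668 / 10000) t :=
    Packs.block (by norm_num) 2 2 ht ct (by norm_num) (by norm_num)
  have bq₁ : Packs (2501 / 10000) (6668 / 10000) q₁ :=
    Packs.block (by norm_num) 1 2 hq.1 cq₁ (by norm_num) (by norm_num)
  have bn : Packs (2 / 25) (6668 / 10000) n :=
    Packs.block (by norm_num) 1 8 hn cn (by norm_num) (by norm_num)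
  have bq₂ : Packs 1 (2501 / 10000) q₂ :=
    Packs.block (by norm_num) 1 1 hq.2 cq₂ (by norm_num) (by norm_num)
  have low := ((bt.beside bq₁ (by norm_num) (by norm_num)).beside bn (by norm_num)
    (by norm_num)).mono (w' := 1) (by norm_num) le_rfl
  have all := (low.above bq₂ (by norm_num) (by norm_num)).mono (h' := 1) le_rfl (by norm_num)
  convert all using 1
  abel

lemma packs_small (n : Multiset Item) (hn : ∀ x ∈ n, side x ≤ 2 / 25) (cn : n.card ≤ 144) :
    Packs 1 1 n :=
  Packs.block (by norm_num) 12 12 hn cn (by norm_num) (by norm_num)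

lemma packIn_corner_thirds {σ : ℝ} (h1 : 1 / 3 ≤ σ) (h2 : σ ≤ 3334 / 10000) (k : ℕ)
    (u t q n : Multiset Item) (hu : ∀ x ∈ u, side x ≤ 1 - σ) (ht : ∀ x ∈ t, side x ≤ σ)
    (hq : ∀ x ∈ q, side x ≤ 2501 / 10000) (hn : ∀ x ∈ n, side x ≤ 2 / 25)
    (cu : u.card ≤ 1 * k) (ct : t.card ≤ 3 * k) (cq : q.card ≤ 2 * k) (cn : n.card ≤ 6 * k) :
    PackIn k (u + t + q + n) :=
  PackIn.of_caps (packs_corner_thirds h1 h2) k u t q n hu ht hq hn cu ct cq cn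

lemma packIn_corner_quarters {σ : ℝ} (h1 : 1 / 4 ≤ σ) (h2 : σ ≤ 2501 / 10000) (k : ℕ)
    (u q n : Multiset Item) (hu : ∀ x ∈ u, side x ≤ 1 - σ) (hq : ∀ x ∈ q, side x ≤ σ)
    (hn : ∀ x ∈ n, side x ≤ 2 / 25)
    (cu : u.card ≤ 1 * k) (cq : q.card ≤ 5 * k) (cn : n.card ≤ 15 * k) :
    PackIn k (u + q + n) := by
  have := PackIn.of_caps (P₄ := fun _ => False) (c₄ := 0)
    (fun m₁ m₂ m₃ m₄ p1 p2 p3 _ c1 c2 c3 c4 => by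
      rw [Nat.le_zero, Multiset.card_eq_zero] at c4
      rw [c4, add_zero]
      exact packs_corner_quarters h1 h2 m₁ m₂ m₃ p1 p2 p3 c1 c2 c3)
    k u q n 0 hu hq hn (by simp) cu cq cn (by simp)
  rwa [add_zero] at this

lemma packIn_quarters (k : ℕ) (q n : Multiset Item) (hq : ∀ x ∈ q, side x ≤ 2501 / 10000)
    (hn : ∀ x ∈ n, side x ≤ 2 / 25) (cq : q.card ≤ 9 * k) (cn : n.card ≤ 27 * k) :
    PackIn k (q + n) := by
  have := PackIn.of_caps (P₃ := fun _ => False) (c₃ := 0) (P₄ := fun _ => False) (c₄ := 0)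
    (fun m₁ m₂ m₃ m₄ p1 p2 _ _ c1 c2 c3 c4 => by
      rw [Nat.le_zero, Multiset.card_eq_zero] at c3 c4
      rw [c3, c4, add_zero, add_zero]
      exact packs_quarters m₁ m₂ p1 p2 c1 c2)
    k q n 0 0 hq hn (by simp) (by simp) cq cn (by simp) (by simp)
  rwa [add_zero, add_zero] at this

lemma packIn_thirds (k : ℕ) (t q n : Multiset Item) (ht : ∀ x ∈ t, side x ≤ 3334 / 10000)
    (hq : ∀ x ∈ q, side x ≤ 2501 / 10000) (hn : ∀ x ∈ n, side x ≤ 2 / 25)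
    (ct : t.card ≤ 4 * k) (cq : q.card ≤ 3 * k) (cn : n.card ≤ 8 * k) :
    PackIn k (t + q + n) := by
  have := PackIn.of_caps (P₄ := fun _ => False) (c₄ := 0)
    (fun m₁ m₂ m₃ m₄ p1 p2 p3 _ c1 c2 c3 c4 => by
      rw [Nat.le_zero, Multiset.card_eq_zero] at c4
      rw [c4, add_zero]
      exact packs_thirds m₁ m₂ m₃ p1 p2 p3 c1 c2 c3)
    k t q n 0 ht hq hn (by simp) ct cq cn (by simp)
  rwa [add_zero] at this

lemma packIn_small (k : ℕ) (n : Multiset Item) (hn : ∀ x ∈ n, side x ≤ 2 / 25)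
    (cn : n.card ≤ 144 * k) : PackIn k n := by
  have := PackIn.of_caps (P₂ := fun _ => False) (c₂ := 0) (P₃ := fun _ => False) (c₃ := 0)
    (P₄ := fun _ => False) (c₄ := 0)
    (fun m₁ m₂ m₃ m₄ p1 _ _ _ c1 c2 c3 c4 => by
      rw [Nat.le_zero, Multiset.card_eq_zero] at c2 c3 c4
      rw [c2, c3, c4, add_zero, add_zero, add_zero]
      exact packs_small m₁ p1 c1)
    k n 0 0 0 hn (by simp) (by simp) (by simp) cn (by simp) (by simp) (by simp)
  rwa [add_zero, add_zero, add_zero] at this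

/-! ### Item counts and grid loads per bin. -/

/-- The number of items in bin `b`. -/
def count (L : List (ℕ × Item)) (b : ℕ) : ℕ := (L.filter fun e => e.1 = b).length

/-- The number of points of the grid with mesh `1 / k` that the items in bin `b` must contain. -/
noncomputable def load (L : List (ℕ × Item)) (k b : ℕ) : ℕ :=
  ((L.filter fun e => e.1 = b).map fun e => gridSide k e.2 ^ 2).sum

lemma load_append (L L' : List (ℕ × Item)) (k b : ℕ) :
    load (L ++ L') k b = load L k b + load L' k b := by
  simp [load]

lemma mul_count_le_load {L : List (ℕ × Item)} {k m : ℕ} (b : ℕ)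
    (h : ∀ e ∈ L, (m : ℝ) < k * side e.2) : m ^ 2 * count L b ≤ load L k b := by
  induction L with
  | nil => simp [count, load]
  | cons e L ih =>
    have h1 := ih fun e' he' => h e' (List.mem_cons_of_mem _ he')
    have h2 := sq_le_gridSide_sq (h e List.mem_cons_self)
    by_cases hb : e.1 = b <;> simp [count, load, hb] at h1 ⊢
    · nlinarith
    · exact h1

lemma sq_le_load {L : List (ℕ × Item)} {k m b : ℕ} {e : ℕ × Item} (he : e ∈ L) (hb : e.1 = b)
    (h : (m : ℝ) < k * side e.2) : m ^ 2 ≤ load L k b := by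
  refine (sq_le_gridSide_sq h).trans ?_
  refine List.single_le_sum (by simp) _ ?_
  exact List.mem_map.2 ⟨e, by simp [he, hb], rfl⟩

lemma count_eq_zero {L : List (ℕ × Item)} {b : ℕ} (h : b ∉ (L.map Prod.fst).toFinset) :
    count L b = 0 := by
  rw [count, List.length_eq_zero_iff, List.filter_eq_nil_iff]
  intro e he hb
  exact h (List.mem_toFinset.2 (List.mem_map.2 ⟨e, he, of_decide_eq_true hb⟩))

lemma sum_count {L : List (ℕ × Item)} {S : Finset ℕ} (h : ∀ e ∈ L, e.1 ∈ S) :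
    ∑ b ∈ S, count L b = L.length := by
  induction L with
  | nil => simp [count]
  | cons e L ih =>
    have h1 := ih fun e' he' => h e' (List.mem_cons_of_mem _ he')
    have h2 : ∀ b, count (e :: L) b = (if e.1 = b then 1 else 0) + count L b := by
      intro b
      by_cases hb : e.1 = b <;> simp [count, hb, add_comm]
    simp only [h2, Finset.sum_add_distrib, h1, Finset.sum_ite_eq, h e List.mem_cons_self, if_true,
      List.length_cons, add_comm]

/-! ### The adversary's adaptive phases and the final big items. -/

/-- The adversary can present items with sides in `(lo, hi)` such that exactly the items that open
a new bin have a side above a threshold `τ`. -/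
lemma OnlineAlgorithm.exists_adaptive (A : OnlineAlgorithm) (N : ℕ) : ∀ (P : List Item) (lo hi : ℚ),
    0 < lo → lo < hi → hi ≤ 1 → ∃ (X : List Item) (τ : ℚ), X.length = N ∧
      (∀ s ∈ X, (lo : ℝ) < side s ∧ side s < hi) ∧ lo < τ ∧ τ < hi ∧
      (X.filter fun s => τ < s.1).length + (A.bins [] P).card = (A.bins [] (P ++ X)).card ∧
      (∀ b ∈ A.bins [] (P ++ X), b ∉ A.bins [] P →
        ∃ e ∈ A.trace P X, e.1 = b ∧ (τ : ℝ) < side e.2) := by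
  induction N with
  | zero =>
    intro P lo hi h0 h1 h2
    exact ⟨[], (lo + hi) / 2, rfl, by simp, by linarith, by linarith, by simp, fun b hb hb' =>
      absurd (by simpa only [List.append_nil] using hb) hb'⟩
  | succ N ih =>
    intro P lo hi h0 h1 h2
    let x : Item := ⟨(lo + hi) / 2, by linarith, by linarith⟩
    have hx : side x = (lo + hi) / 2 := by simp [side, x]
    have h1' : (lo : ℝ) < hi := by exact_mod_cast h1
    have hbins : A.bins [] (P ++ [x]) = insert (A.bin P x) (A.bins [] P) := by
      rw [A.bins_append]
      simp [OnlineAlgorithm.bins, OnlineAlgorithm.trace]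
    -- Bisection: after a midpoint put into an old bin the search continues above it, after one that
    -- opens a bin below it. The final `τ` thus separates the two kinds.
    by_cases hopen : A.bin P x ∈ A.bins [] P
    · obtain ⟨X, τ, e1, e2, e3, e4, e5, e6⟩ := ih (P ++ [x]) ((lo + hi) / 2) hi (by linarith)
        (by linarith) h2
      rw [Finset.insert_eq_of_mem hopen] at hbins
      rw [hbins, List.append_assoc, List.singleton_append] at e5 e6
      refine ⟨x :: X, τ, by simp [e1], ?_, by linarith, e4, ?_, ?_⟩
      · rw [List.forall_mem_cons]
        refine ⟨by rw [hx]; constructor <;> linarith, fun s hs => ?_⟩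
        have := e2 s hs
        push_cast at this
        exact ⟨by linarith, this.2⟩
      · rw [← e5, List.filter_cons_of_neg]
        simpa [x] using e3.le
      · intro b hb hb'
        obtain ⟨e, he, h⟩ := e6 b hb hb'
        exact ⟨e, by rw [OnlineAlgorithm.trace]; exact List.mem_cons_of_mem _ he, h⟩
    · obtain ⟨X, τ, e1, e2, e3, e4, e5, e6⟩ := ih (P ++ [x]) lo ((lo + hi) / 2) h0
        (by linarith) (by linarith)
      rw [List.append_assoc, List.singleton_append] at e5 e6
      have hτ : (τ : ℝ) < side x := by
        have : (τ : ℝ) < ((lo + hi) / 2 : ℚ) := by exact_mod_cast e4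
        rw [hx]
        push_cast at this
        exact this
      refine ⟨x :: X, τ, by simp [e1], ?_, e3, by linarith, ?_, ?_⟩
      · rw [List.forall_mem_cons]
        refine ⟨by rw [hx]; constructor <;> linarith, fun s hs => ?_⟩
        have := e2 s hs
        push_cast at this
        exact ⟨this.1, by linarith⟩
      · rw [← e5, hbins, Finset.card_insert_of_notMem hopen, List.filter_cons_of_pos,
          List.length_cons]
        · ring
        · simpa [x] using e4
      · intro b hb hb'
        by_cases hbx : b = A.bin P x
        · exact ⟨(A.bin P x, x), by rw [OnlineAlgorithm.trace]; exact List.mem_cons_self, hbx.symm,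
            hτ⟩
        · obtain ⟨e, he, h⟩ := e6 b hb (by rw [hbins, Finset.mem_insert]; tauto)
          exact ⟨e, by rw [OnlineAlgorithm.trace]; exact List.mem_cons_of_mem _ he, h⟩

/-- The cost of presenting `M` equal items of side more than `1 / 2`, in terms of the set of old
bins that receive one of them. -/
lemma OnlineAlgorithm.exists_receiving (A : OnlineAlgorithm) (P : List Item) (u : Item)
    (hu : 1 / 2 < side u) (M : ℕ) : ∃ S ⊆ A.bins [] P,
      (A.bins [] P).card + M ≤ A.cost (P ++ List.replicate M u) + S.card ∧
      ∀ b ∈ S, (∀ k m : ℕ, 0 < k → (m : ℝ) < k * side u →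
          load (A.trace [] P) k b + m ^ 2 ≤ (k - 1) ^ 2) ∧
        ∀ e ∈ A.trace [] P, e.1 = b → side e.2 + side u ≤ 1 := by
  have hmem : ∀ e ∈ A.trace P (List.replicate M u), e.2 = u := by
    intro e he
    have : e.2 ∈ (A.trace P (List.replicate M u)).map Prod.snd := List.mem_map_of_mem he
    rw [A.trace_map_snd] at this
    exact List.eq_of_mem_replicate this
  have hpw := A.pairwise_side_add_le (P ++ List.replicate M u)
  rw [A.trace_append, List.nil_append, List.pairwise_append] at hpw
  -- Two squares of side above 1/2 never share a bin, so the `M` items occupy `M` distinct bins.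
  have hcard : (A.bins P (List.replicate M u)).card = M := by
    rw [OnlineAlgorithm.bins, List.toFinset_card_of_nodup]
    · rw [List.length_map, A.trace_length, List.length_replicate]
    · rw [List.Nodup, List.pairwise_map]
      refine hpw.2.1.imp_of_mem ?_
      intro e e' he he' h hee
      have := h hee
      rw [hmem e he, hmem e' he'] at this
      linarith
  refine ⟨A.bins [] P ∩ A.bins P (List.replicate M u), Finset.inter_subset_left, ?_, ?_⟩
  · rw [A.cost_eq, A.bins_append, List.nil_append, Finset.card_union_add_card_inter, hcard]
  · intro b hb
    obtain ⟨e', he', hb'⟩ : ∃ e' ∈ A.trace P (List.replicate M u), e'.1 = b := by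
      have := (Finset.mem_inter.1 hb).2
      rw [OnlineAlgorithm.bins, List.mem_toFinset, List.mem_map] at this
      exact this
    have hue := hmem e' he'
    constructor
    · intro k m hk hm
      have h := A.sum_gridSide_sq_le (P ++ List.replicate M u) b hk
      rw [A.trace_append, List.nil_append] at h
      change load _ k b ≤ _ at h
      rw [load_append] at h
      have := sq_le_load he' hb' (k := k) (m := m) (by rwa [hue])
      omega
    · intro e he hbe
      have := hpw.2.2 e he e' he' (hbe.trans hb'.symm)
      rwa [hue] at this

/-! ### The weight inequality for a single bin. -/

/-- The weight of a bin with `a` items of side about `1 / 12`, `q` items of side about `1 / 4` and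
`t` items of side about `1 / 3`. The sets `S₀`, `S₁`, `S₂` are the sets of bins used after each of
the three phases, and `C`, `D`, `E` are sets of bins that receive one more large item. -/
lemma bin_weight_le {a q t b : ℕ} {S₀ S₁ C D E : Finset ℕ} (h₀₁ : S₀ ⊆ S₁)
    (h13 : a * 1 + q * 9 + t * 16 ≤ 144) (h4 : q + t ≤ 9) (h3 : t ≤ 4)
    (ha : b ∉ S₀ → a = 0) (hq : b ∉ S₁ → q = 0)
    (hC : b ∈ C → b ∈ S₀ ∧ q ≤ 5 ∧ a + q * 9 ≤ 63)
    (hD : b ∈ D → t ≤ 3 ∧ q + t ≤ 5 ∧ a + q * 9 + t * 16 ≤ 80)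
    (hE : b ∈ E → b ∈ S₁ ∧ t ≤ 3 ∧ q + t ≤ 5 ∧ a + q * 9 + t * 16 ≤ 80) :
    (4 * a + 32 * q + 27 * t : ℤ) ≤ 109 + 179 * (if b ∈ S₁ then 1 else 0) +
      288 * (if b ∈ S₀ then 1 else 0) - 168 * (if b ∈ C then 1 else 0) -
      28 * (if b ∈ D then 1 else 0) - 100 * (if b ∈ E then 1 else 0) := by
  have h01 : b ∈ S₀ → b ∈ S₁ := fun h => h₀₁ h
  -- Tight cases include 144 small items in a bin of `S₀` without big items, nine quarters in one of
  -- `S₁ \ S₀`, five quarters in one of `S₁ \ S₀` lying in `D` and `E`, and three thirds in a bin of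
  -- `D` outside `S₁`.
  by_cases b0 : b ∈ S₀ <;> by_cases b1 : b ∈ S₁ <;> by_cases bC : b ∈ C <;>
    by_cases bD : b ∈ D <;> by_cases bE : b ∈ E <;>
    simp only [b0, b1, bC, bD, bE, if_true, if_false, not_true, not_false_iff, true_and, false_and,
      forall_true_left, imp_false, false_imp_iff] at * <;> omega

lemma sum_mem_eq_card {S T : Finset ℕ} (h : T ⊆ S) :
    ∑ b ∈ S, (if b ∈ T then 1 else 0 : ℤ) = T.card := by
  rw [← Finset.sum_filter, Finset.filter_mem_eq_inter, Finset.inter_eq_right.2 h]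
  simp

lemma filter_lt_add_filter_le (X : List Item) (τ : ℚ) :
    ((X.filter fun s => τ < s.1 : List Item) : Multiset Item) +
      (X.filter fun s => ¬ τ < s.1 : List Item) = X := by
  rw [← Multiset.filter_coe, ← Multiset.filter_coe]
  exact Multiset.filter_add_not _ _

lemma OnlineAlgorithm.mem_of_mem_trace {A : OnlineAlgorithm} {P l : List Item} {e : ℕ × Item}
    (he : e ∈ A.trace P l) : e.2 ∈ l := by
  have : e.2 ∈ (A.trace P l).map Prod.snd := List.mem_map_of_mem he
  rwa [A.trace_map_snd] at this

lemma length_filter_add (X : List Item) (τ : ℚ) :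
    (X.filter fun s => τ < s.1).length + (X.filter fun s => ¬ τ < s.1).length = X.length := by
  have := congrArg Multiset.card (filter_lt_add_filter_le X τ)
  simpa only [Multiset.card_add, Multiset.coe_card] using this

lemma side_le_of_mem_filter {X : List Item} {τ : ℚ} {s : Item}
    (h : s ∈ X.filter fun s => ¬ τ < s.1) : side s ≤ τ := by
  have := of_decide_eq_true (List.mem_filter.1 h).2
  rw [not_lt] at this
  unfold side
  exact_mod_cast this

/-! ### Offline costs at the stopping points with big items. -/

/-- Small items, items of side about `1 / 4` and big items that fit only with the items of side at
most `τ`. -/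
lemma opt_quarters_le {Z X : List Item} {u : Item} {τ : ℚ} (M k : ℕ)
    (hZ : ∀ s ∈ Z, side s ≤ 2 / 25) (hX : ∀ s ∈ X, side s ≤ 2501 / 10000)
    (h1 : 1 / 4 ≤ τ) (h2 : τ ≤ 2501 / 10000) (hu : side u = 1 - τ)
    (hs : (X.filter fun s => ¬ τ < s.1).length ≤ 5 * M)
    (hl : (X.filter fun s => τ < s.1).length ≤ 9 * k) (hn : Z.length ≤ 15 * M + 27 * k) :
    opt (Z ++ X ++ List.replicate M u) ≤ M + k := by
  have h1' : (1 / 4 : ℝ) ≤ τ := by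
    have := (Rat.cast_le (K := ℝ)).2 h1
    push_cast at this
    exact this
  have h2' : (τ : ℝ) ≤ 2501 / 10000 := by
    have := (Rat.cast_le (K := ℝ)).2 h2
    push_cast at this
    exact this
  obtain ⟨n₁, n₂, hZn, c1, c2⟩ := exists_split (Z : Multiset Item) hn
  have hZ' : ∀ s ∈ n₁ + n₂, side s ≤ 2 / 25 := by
    rw [← hZn]
    exact hZ
  simp only [Multiset.mem_add, or_imp, forall_and] at hZ'
  have p1 := packIn_corner_quarters h1' h2' M (List.replicate M u : List Item)
    (X.filter fun s => ¬ τ < s.1 : List Item) n₁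
    (fun s hs => by rw [List.eq_of_mem_replicate hs, hu])
    (fun s hs => side_le_of_mem_filter hs) hZ'.1 (by simp) hs c1
  have p2 := packIn_quarters k (X.filter fun s => τ < s.1 : List Item) n₂
    (fun s hs => hX s (List.mem_of_mem_filter hs)) hZ'.2 hl c2
  refine PackIn.opt_le ?_
  convert p1.add p2 using 1
  rw [← Multiset.coe_add, ← Multiset.coe_add, hZn, ← filter_lt_add_filter_le X τ]
  abel

/-- Thirds of side at most `τ` surround the big items; those above `τ` go four to a bin without big
items. The quarters and small items fill the gaps of both kinds of bin. -/
lemma opt_thirds_le {Z X Y : List Item} {u : Item} {τ : ℚ} (M k : ℕ)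
    (hZ : ∀ s ∈ Z, side s ≤ 2 / 25) (hX : ∀ s ∈ X, side s ≤ 2501 / 10000)
    (hY : ∀ s ∈ Y, side s ≤ 3334 / 10000)
    (h1 : 1 / 3 ≤ τ) (h2 : τ ≤ 3334 / 10000) (hu : side u = 1 - τ)
    (hs : (Y.filter fun s => ¬ τ < s.1).length ≤ 3 * M)
    (hl : (Y.filter fun s => τ < s.1).length ≤ 4 * k)
    (hq : X.length ≤ 2 * M + 3 * k) (hn : Z.length ≤ 6 * M + 8 * k) :
    opt (Z ++ X ++ Y ++ List.replicate M u) ≤ M + k := by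
  have h1' : (1 / 3 : ℝ) ≤ τ := by
    have := (Rat.cast_le (K := ℝ)).2 h1
    push_cast at this
    exact this
  have h2' : (τ : ℝ) ≤ 3334 / 10000 := by
    have := (Rat.cast_le (K := ℝ)).2 h2
    push_cast at this
    exact this
  obtain ⟨n₁, n₂, hZn, c1, c2⟩ := exists_split (Z : Multiset Item) hn
  obtain ⟨q₁, q₂, hXq, d1, d2⟩ := exists_split (X : Multiset Item) hq
  have hZ' : ∀ s ∈ n₁ + n₂, side s ≤ 2 / 25 := by
    rw [← hZn]
    exact hZ
  have hX' : ∀ s ∈ q₁ + q₂, side s ≤ 2501 / 10000 := by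
    rw [← hXq]
    exact hX
  simp only [Multiset.mem_add, or_imp, forall_and] at hZ' hX'
  have p1 := packIn_corner_thirds h1' h2' M (List.replicate M u : List Item)
    (Y.filter fun s => ¬ τ < s.1 : List Item) q₁ n₁
    (fun s hs => by rw [List.eq_of_mem_replicate hs, hu])
    (fun s hs => side_le_of_mem_filter hs) hX'.1 hZ'.1 (by simp) hs d1 c1
  have p2 := packIn_thirds k (Y.filter fun s => τ < s.1 : List Item) q₂ n₂
    (fun s hs => hY s (List.mem_of_mem_filter hs)) hX'.2 hZ'.2 hl d2 c2
  refine PackIn.opt_le ?_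
  convert p1.add p2 using 1
  rw [← Multiset.coe_add, ← Multiset.coe_add, ← Multiset.coe_add, hZn, hXq,
    ← filter_lt_add_filter_le Y τ]
  abel

/-- These big items leave room for every third, so one layout with `σ = 0.3334` serves all bins and
no threshold is needed. -/
lemma opt_two_thirds_le {Z X Y : List Item} {u : Item} (M : ℕ)
    (hZ : ∀ s ∈ Z, side s ≤ 2 / 25) (hX : ∀ s ∈ X, side s ≤ 2501 / 10000)
    (hY : ∀ s ∈ Y, side s ≤ 3334 / 10000) (hu : side u ≤ 6666 / 10000)
    (ht : Y.length ≤ 3 * M) (hq : X.length ≤ 2 * M) (hn : Z.length ≤ 6 * M) :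
    opt (Z ++ X ++ Y ++ List.replicate M u) ≤ M := by
  have p := packIn_corner_thirds (σ := 3334 / 10000) (by norm_num) le_rfl M
    (List.replicate M u : List Item) Y X Z
    (fun s hs => by rw [List.eq_of_mem_replicate hs]; linarith) hY hX hZ (by simp) ht hq hn
  refine PackIn.opt_le ?_
  convert p using 1
  rw [← Multiset.coe_add, ← Multiset.coe_add, ← Multiset.coe_add]
  abel

/-! ### The contradiction. -/

/-- The four stopping points of the adversary cannot all be handled within `1.7515445 * opt`. -/
lemma OnlineAlgorithm.false_of_cost_le (A : OnlineAlgorithm) (Q : ℕ)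
    (h : ∀ I, Q ≤ opt I → (A.cost I : ℝ) ≤ 1.7515445 * opt I) : False := by
  -- With `K = 24 * j` the `6K` small items fill `j` bins of 144. The summand `Q` makes every
  -- optimum large enough, and 100 absorbs all rounding errors.
  obtain ⟨j, hj⟩ : ∃ j, j = Q + 100 := ⟨_, rfl⟩
  obtain ⟨K, hK⟩ : ∃ K, K = 24 * j := ⟨_, rfl⟩
  let z : Item := ⟨2 / 25, by norm_num, by norm_num⟩
  have hz : side z = 2 / 25 := by simp [side, z]
  obtain ⟨Z, hZdef⟩ : ∃ Z, Z = List.replicate (6 * K) z := ⟨_, rfl⟩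
  have hZ : ∀ s ∈ Z, side s = 2 / 25 := fun s hs => by
    rw [hZdef] at hs
    rw [List.eq_of_mem_replicate hs, hz]
  have cZ : Z.length = 6 * K := by rw [hZdef, List.length_replicate]
  obtain ⟨X, τ, cX, hX, hτ1, hτ2, hXl, hXb⟩ := A.exists_adaptive (2 * K) Z (1 / 4) (2501 / 10000)
    (by norm_num) (by norm_num) (by norm_num)
  obtain ⟨Y, σ, cY, hY, hσ1, hσ2, hYl, hYb⟩ := A.exists_adaptive (3 * K) (Z ++ X) (1 / 3)
    (3334 / 10000) (by norm_num) (by norm_num) (by norm_num)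
  push_cast at hX hY
  have hXs := length_filter_add X τ
  have hYs := length_filter_add Y σ
  rw [cX] at hXs
  rw [cY] at hYs
  set lq := (X.filter fun s => τ < s.1).length with hlq
  set sq := (X.filter fun s => ¬ τ < s.1).length with hsq
  set lt := (Y.filter fun s => σ < s.1).length with hlt
  set st := (Y.filter fun s => ¬ σ < s.1).length with hst
  let u : Item := ⟨1 - τ, by linarith, by linarith⟩
  let v : Item := ⟨33 / 50, by norm_num, by norm_num⟩
  let w : Item := ⟨1 - σ, by linarith, by linarith⟩
  have hu : side u = 1 - τ := by simp [side, u]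
  have hv : side v = 33 / 50 := by simp [side, v]
  have hw : side w = 1 - σ := by simp [side, w]
  have hτ1' : (1 / 4 : ℝ) < τ := by
    have := (Rat.cast_lt (K := ℝ)).2 hτ1
    push_cast at this
    exact this
  have hτ2' : (τ : ℝ) < 2501 / 10000 := by
    have := (Rat.cast_lt (K := ℝ)).2 hτ2
    push_cast at this
    exact this
  have hσ1' : (1 / 3 : ℝ) < σ := by
    have := (Rat.cast_lt (K := ℝ)).2 hσ1
    push_cast at this
    exact this
  have hσ2' : (σ : ℝ) < 3334 / 10000 := by
    have := (Rat.cast_lt (K := ℝ)).2 hσ2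
    push_cast at this
    exact this
  obtain ⟨M, hM⟩ : ∃ M, M = sq / 5 + 1 := ⟨_, rfl⟩
  obtain ⟨N, hN⟩ : ∃ N, N = st / 3 + 1 := ⟨_, rfl⟩
  obtain ⟨C, hCsub, hCcost, hC⟩ := A.exists_receiving (Z ++ X) u (by rw [hu]; linarith) M
  obtain ⟨D, hDsub, hDcost, hD⟩ := A.exists_receiving (Z ++ X ++ Y) v (by rw [hv]; norm_num) K
  obtain ⟨E, hEsub, hEcost, hE⟩ := A.exists_receiving (Z ++ X ++ Y) w (by rw [hw]; linarith) N
  have hQ : ∀ l, Q ≤ opt (Z ++ l) := by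
    intro l
    have := length_le_mul_opt A (l := Z) (l' := l) (k := 13)
      (fun s hs => by rw [hZ s hs]; norm_num)
    omega
  have hZ' : ∀ s ∈ Z, side s ≤ 2 / 25 := fun s hs => (hZ s hs).le
  have hX' : ∀ s ∈ X, side s ≤ 2501 / 10000 := fun s hs => (hX s hs).2.le
  have hY' : ∀ s ∈ Y, side s ≤ 3334 / 10000 := fun s hs => (hY s hs).2.le
  have o0 : opt Z ≤ j := (packIn_small j Z hZ' (by simp; omega)).opt_le
  -- Both layouts accommodate three small items per quarter (15 to 5 and 27 to 9), which is the
  -- ratio `6K` to `2K`.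
  have o1 : opt (Z ++ X ++ List.replicate M u) ≤ M + (lq / 9 + 1) :=
    opt_quarters_le M (lq / 9 + 1) hZ' hX' hτ1.le hτ2.le hu (by omega) (by omega) (by omega)
  have o2 : opt (Z ++ X ++ Y ++ List.replicate K v) ≤ K :=
    opt_two_thirds_le K hZ' hX' hY' (by rw [hv]; norm_num) (by omega) (by omega) (by omega)
  have o3 : opt (Z ++ X ++ Y ++ List.replicate N w) ≤ N + (lt / 4 + 1) :=
    opt_thirds_le N (lt / 4 + 1) hZ' hX' hY' hσ1.le hσ2.le hw (by omega) (by omega) (by omega)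
      (by omega)
  have r0 := h Z (by simpa using hQ [])
  have r1 := h (Z ++ X ++ List.replicate M u) (by rw [List.append_assoc]; exact hQ _)
  have r2 := h (Z ++ X ++ Y ++ List.replicate K v) (by
    rw [List.append_assoc, List.append_assoc]; exact hQ _)
  have r3 := h (Z ++ X ++ Y ++ List.replicate N w) (by
    rw [List.append_assoc, List.append_assoc]; exact hQ _)
  rw [A.cost_eq] at r0
  have hS01 : A.bins [] Z ⊆ A.bins [] (Z ++ X) := by
    rw [A.bins_append]
    exact Finset.subset_union_left
  have hS12 : A.bins [] (Z ++ X) ⊆ A.bins [] (Z ++ X ++ Y) := by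
    rw [A.bins_append [] (Z ++ X)]
    exact Finset.subset_union_left
  have ht1 : A.trace [] (Z ++ X) = A.trace [] Z ++ A.trace Z X := by
    rw [A.trace_append, List.nil_append]
  have ht2 : A.trace [] (Z ++ X ++ Y) = A.trace [] Z ++ A.trace Z X ++ A.trace (Z ++ X) Y := by
    rw [A.trace_append, ht1, List.nil_append]
  have sZ : ∀ e ∈ A.trace [] Z, side e.2 = 2 / 25 := fun e he => hZ _ (mem_of_mem_trace he)
  have sX : ∀ e ∈ A.trace Z X, 1 / 4 < side e.2 := fun e he => (hX _ (mem_of_mem_trace he)).1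
  have sY : ∀ e ∈ A.trace (Z ++ X) Y, 1 / 3 < side e.2 := fun e he =>
    (hY _ (mem_of_mem_trace he)).1
  have weight : ∀ b ∈ A.bins [] (Z ++ X ++ Y),
      (4 * count (A.trace [] Z) b + 32 * count (A.trace Z X) b +
        27 * count (A.trace (Z ++ X) Y) b : ℤ) ≤
      109 + 179 * (if b ∈ A.bins [] (Z ++ X) then 1 else 0) +
        288 * (if b ∈ A.bins [] Z then 1 else 0) - 168 * (if b ∈ C then 1 else 0) -
        28 * (if b ∈ D then 1 else 0) - 100 * (if b ∈ E then 1 else 0) := by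
    intro b hb
    -- Grid sizes come from 1/13 < 2/25, 3/13 < 1/4 and 4/13 < 1/3: the items take 1, 9 and 16 of
    -- the 144 points.
    have z13 := mul_count_le_load (k := 13) (m := 1) b (L := A.trace [] Z)
      (fun e he => by rw [sZ e he]; norm_num)
    have x13 := mul_count_le_load (k := 13) (m := 3) b (L := A.trace Z X)
      (fun e he => by have := sX e he; push_cast; linarith)
    have y13 := mul_count_le_load (k := 13) (m := 4) b (L := A.trace (Z ++ X) Y)
      (fun e he => by have := sY e he; push_cast; linarith)
    have x4 := mul_count_le_load (k := 4) (m := 1) b (L := A.trace Z X)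
      (fun e he => by have := sX e he; push_cast; linarith)
    have y4 := mul_count_le_load (k := 4) (m := 1) b (L := A.trace (Z ++ X) Y)
      (fun e he => by have := sY e he; push_cast; linarith)
    have y3 := mul_count_le_load (k := 3) (m := 1) b (L := A.trace (Z ++ X) Y)
      (fun e he => by have := sY e he; push_cast; linarith)
    have l13 := A.sum_gridSide_sq_le (Z ++ X ++ Y) b (k := 13) (by norm_num)
    have l4 := A.sum_gridSide_sq_le (Z ++ X ++ Y) b (k := 4) (by norm_num)
    have l3 := A.sum_gridSide_sq_le (Z ++ X ++ Y) b (k := 3) (by norm_num)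
    rw [ht2] at l13 l4 l3
    change load _ 13 b ≤ _ at l13
    change load _ 4 b ≤ _ at l4
    change load _ 3 b ≤ _ at l3
    rw [load_append, load_append] at l13 l4 l3
    refine bin_weight_le hS01 (by omega) (by omega) (by omega) count_eq_zero (fun hb1 => ?_)
      (fun hbC => ?_) (fun hbD => ?_) (fun hbE => ?_)
    · refine count_eq_zero fun hb2 => hb1 ?_
      rw [A.bins_append, List.nil_append]
      exact Finset.mem_union_right _ hb2
    · obtain ⟨hload, hpair⟩ := hC b hbC
      rw [ht1] at hload hpair
      refine ⟨?_, ?_⟩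
      · by_contra hb0
        -- A bin opened in the second phase holds an item above `τ`, which with `u` exceeds total
        -- side 1.
        obtain ⟨e, he, heb, hlarge⟩ := hXb b (hCsub hbC) hb0
        have := hpair e (List.mem_append_right _ he) heb
        rw [hu] at this
        linarith
      · have c13 := hload 13 9 (by norm_num) (by rw [hu]; push_cast; linarith)
        have c4 := hload 4 2 (by norm_num) (by rw [hu]; push_cast; linarith)
        rw [load_append] at c13 c4
        omega
    · have hload := (hD b hbD).1
      rw [ht2] at hload
      -- Here 80, 5 and 3 points remain at the meshes 1/13, 1/4 and 1/3.
      have c13 := hload 13 8 (by norm_num) (by rw [hv]; norm_num)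
      have c4 := hload 4 2 (by norm_num) (by rw [hv]; norm_num)
      have c3 := hload 3 1 (by norm_num) (by rw [hv]; norm_num)
      rw [load_append, load_append] at c13 c4 c3
      omega
    · obtain ⟨hload, hpair⟩ := hE b hbE
      rw [ht2] at hload hpair
      refine ⟨?_, ?_⟩
      · by_contra hb1
        obtain ⟨e, he, heb, hlarge⟩ := hYb b hb hb1
        have := hpair e (List.mem_append_right _ he) heb
        rw [hw] at this
        linarith
      · have c13 := hload 13 8 (by norm_num) (by rw [hw]; push_cast; linarith)
        have c4 := hload 4 2 (by norm_num) (by rw [hw]; push_cast; linarith)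
        have c3 := hload 3 1 (by norm_num) (by rw [hw]; push_cast; linarith)
        rw [load_append, load_append] at c13 c4 c3
        omega
  have mem_bins : ∀ e ∈ A.trace [] (Z ++ X ++ Y), e.1 ∈ A.bins [] (Z ++ X ++ Y) := fun e he =>
    List.mem_toFinset.2 (List.mem_map_of_mem he)
  rw [ht2] at mem_bins
  have cz := sum_count (L := A.trace [] Z) (fun e he => mem_bins e (by simp [he]))
  have cx := sum_count (L := A.trace Z X) (fun e he => mem_bins e (by simp [he]))
  have cy := sum_count (L := A.trace (Z ++ X) Y) (fun e he => mem_bins e (by simp [he]))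
  rw [A.trace_length] at cz cx cy
  have total := Finset.sum_le_sum weight
  simp only [Finset.sum_add_distrib, Finset.sum_sub_distrib, ← Finset.mul_sum, Finset.sum_const,
    nsmul_eq_mul] at total
  rw [sum_mem_eq_card hS12, sum_mem_eq_card (hS01.trans hS12), sum_mem_eq_card (hCsub.trans hS12),
    sum_mem_eq_card hDsub, sum_mem_eq_card hEsub] at total
  rw [← Nat.cast_sum, ← Nat.cast_sum, ← Nat.cast_sum, cz, cx, cy, cX, cY, cZ] at total
  obtain ⟨x, hx⟩ : ∃ x, x = lq / 9 + 1 := ⟨_, rfl⟩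
  obtain ⟨y, hy⟩ : ∃ y, y = lt / 4 + 1 := ⟨_, rfl⟩
  rw [← hx] at o1
  rw [← hy] at o3
  have e1 : 9 * x ≤ lq + 9 := by omega
  have e2 : 4 * y ≤ lt + 4 := by omega
  have e3 : 5 * M ≤ sq + 5 := by omega
  have e4 : 3 * N ≤ st + 3 := by omega
  have e5 : 100 ≤ j := by omega
  clear_value lq sq lt st
  generalize (A.bins [] Z).card = c0 at *
  generalize (A.bins [] (Z ++ X)).card = c1 at *
  generalize (A.bins [] (Z ++ X ++ Y)).card = c2 at *
  rify at total hXs hYs hXl hYl hCcost hDcost hEcost o0 o1 o2 o3 e1 e2 e3 e4 e5 hK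
  -- Multipliers 288, 168, 28 and 100 for `r0`, `r1`, `r2` and `r3` suffice. With `R = 1.7515445`,
  -- and the `lq`, `lt` terms rewritten through the bin counts, `total` yields `169 K ≤ (207.2 R -
  -- 195.2) K` plus a constant below 700. The coefficient on the right is below 167.8 and `K ≥
  -- 2400`.
  linarith

end SquarePacking

theorem theorem3 (A : SquarePacking.OnlineAlgorithm) :
    ENNReal.ofReal 1.7515445 ≤ A.competitiveRatio := by
  by_contra hlt
  rw [not_le, SquarePacking.OnlineAlgorithm.competitiveRatio] at hlt
  obtain ⟨Q, hQ⟩ := Filter.eventually_atTop.1 (Filter.eventually_lt_of_limsup_lt hlt)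
  -- The shift by one makes `opt I` positive, so the quotient can be cleared.
  refine A.false_of_cost_le (Q + 1) fun I hI => ?_
  have hpos : 0 < SquarePacking.opt I := by omega
  have h1 := (hQ (SquarePacking.opt I) (by omega)).le
  rw [ENNReal.div_le_iff (by exact_mod_cast hpos.ne') (ENNReal.natCast_ne_top _)] at h1
  have h2 : (A.cost I : ℝ≥0∞) ≤ A.worstCost (SquarePacking.opt I) :=
    le_iSup₂ (f := fun (J : List SquarePacking.Item)
      (_ : SquarePacking.opt J = SquarePacking.opt I) => (A.cost J : ℝ≥0∞)) I rfl
  have h3 := h2.trans h1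
  rw [← ENNReal.ofReal_natCast, ← ENNReal.ofReal_natCast (SquarePacking.opt I),
    ← ENNReal.ofReal_mul (by norm_num), ENNReal.ofReal_le_ofReal_iff (by positivity)] at h3
  exact h3
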